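/- Let $\mathbb{K}$ be a field, let $V$ be a $\mathbb{K}$-vector space with basis $x_1,\dots,x_n$ ($n \ge 0$), and let $T(V)=\mathbb{K}\langle x_1,\dots,x_n\rangle$ be its tensor algebra, with the filtration $F_i(T)=\bigoplus_{j\le i}V^{\otimes j}$. Let $P\subseteq F_2(T)$ be a subspace, let $\pi:F_2(T)\to V\otimes V$ be the projection, and put $R=\pi(P)$, $A=T(V)/\langle P\rangle$, $B=T(V)/\langle R\rangle$, where $\langle\cdot\rangle$ denotes the two-sided ideal generated. Assume: (a) $A$ is a PBW deformation of $B$: the natural epimorphism $p:B\to \mathrm{Gr}(A)$ onto the associated graded algebra of $A$, for the filtration inherited from $T(V)$, is an isomorphism; (b) $B$ is a skew PBW extension of $\mathbb{K}$ in the variables $x_1,\dots,x_n$: $\mathbb{K}\subseteq B$; the standard monomials $x_1^{\alpha_1}\cdots x_n^{\alpha_n}$, $\alpha\in\mathbb{N}^n$, form a basis of the left $\mathbb{K}$-module $B$; for all $i$ and all $r\in\mathbb{K}\setminus\{0\}$ there is $c_{i,r}\in\mathbb{K}\setminus\{0\}$ with $x_ir-c_{i,r}x_i\in\mathbb{K}$;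 and for all $i,j$ there is $c_{i,j}\in\mathbb{K}\setminus\{0\}$ with $x_jx_i-c_{i,j}x_ix_j\in\mathbb{K}+\mathbb{K}x_1+\cdots+\mathbb{K}x_n$. Then $B$ is homogeneous Koszul: it is a quotient of the free algebra on finitely many generators by the two-sided ideal generated by a set of homogeneous quadratic elements, and the trivial graded $B$-module $\mathbb{K}$ has a resolution $\cdots\to P_2\to P_1\to P_0\to\mathbb{K}\to 0$ by graded free $B$-modules and degree-preserving maps in which $P_i$ is generated in degree $i$ for every $i \ge 0$. Moreover, $B$ is a semi-commutative skew PBW extension of $\mathbb{K}$ in $x_1,\dots,x_n$: for all $i$ and $r\in\mathbb{K}\setminus\{0\}$ there is $c\in\mathbb{K}\setminus\{0\}$ with $x_ir=cx_i$; for all $i,j$ there is $c\in\mathbb{K}\setminus\{0\}$ with $x_jx_i=cx_ix_j$; and every $r\in\mathbb{K}$ satisfies $x_ir=rx_i$ for all $i$. In fact, there are $c_{i,j}\in\mathbb{K}\setminus\{0\}$, $1\le i,j\le n$, such that $x_jx_i=c_{i,j}x_ix_j$ in $B$ for all $i,j$ and $$\langle R\rangle=\langle x_jx_i-c_{i,j}x_ix_j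 \mid 1\le i,j\le n\rangle,\qquad\text{so}\qquad B=\mathbb{K}\langle x_1,\dots,x_n\rangle/\langle x_jx_i-c_{i,j}x_ix_j \mid 1\le i,j\le n\rangle .$$ -/

import Mathlib

open scoped DirectSum

noncomputable section

namespace PBWKoszul

universe u v w

/-! ### Skew PBW extensions -/

section SkewPBW

variable {R : Type*} {A : Type*} [Ring R] [Ring A]

/-- The standard monomial `x₁ ^ α₁ * ⋯ * xₙ ^ αₙ`. -/
def stdMonomial {n : ℕ} (x : Fin n → A) (α : Fin n → ℕ) : A :=
  (List.ofFn fun i => x i ^ α i).prod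

/-- `A` is a skew PBW extension of `R` in the variables `x₁, …, xₙ`; the inclusion `R ⊆ A` is the
ring homomorphism `f`. -/
structure IsSkewPBWExtension (f : R →+* A) {n : ℕ} (x : Fin n → A) : Prop where
  injective : Function.Injective f
  /-- The standard monomials form a basis of the left `R`-module `A`. -/
  basis : Function.Bijective fun c : (Fin n → ℕ) →₀ R => c.sum fun α r => f r * stdMonomial x α
  comm_coeff : ∀ (i : Fin n) (r : R), r ≠ 0 →
    ∃ c : R, c ≠ 0 ∧ ∃ s : R, x i * f r - f c * x i = f s
  comm_var : ∀ i j : Fin n, ∃ c : R, c ≠ 0 ∧ ∃ (r₀ : R) (r : Fin n → R),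
    x j * x i - f c * (x i * x j) = f r₀ + ∑ k, f (r k) * x k

/-- Quasi-commutative skew PBW extensions: `x i * r = c * x i` and `x j * x i = c * x i * x j`
with nonzero `c`. -/
structure IsQuasiCommutative (f : R →+* A) {n : ℕ} (x : Fin n → A) : Prop
    extends IsSkewPBWExtension f x where
  quasi_coeff : ∀ (i : Fin n) (r : R), r ≠ 0 → ∃ c : R, c ≠ 0 ∧ x i * f r = f c * x i
  quasi_var : ∀ i j : Fin n, ∃ c : R, c ≠ 0 ∧ x j * x i = f c * (x i * x j)

/-- Semi-commutative skew PBW extensions: quasi-commutative and constant. Since the standard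
monomials are a basis, `x i * r = σᵢ r * x i + δᵢ r` determines `σᵢ r` and `δᵢ r`, and the
requirement `σᵢ r = r`, `δᵢ r = 0` for all `i` and `r` says `x i * r = r * x i`. -/
structure IsSemiCommutative (f : R →+* A) {n : ℕ} (x : Fin n → A) : Prop
    extends IsQuasiCommutative f x where
  constant : ∀ (i : Fin n) (r : R), x i * f r = f r * x i

end SkewPBW

/-! ### The associated graded algebra of a filtered algebra -/

section AssociatedGraded

variable {K : Type u} [Field K] {A : Type v} [Ring A] [Algebra K A]

/-- The part of the filtration strictly below `i`: it is `F (i - 1)` for an increasing filtration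
and `i > 0`, and it is `0` for `i = 0`. -/
def below (F : ℕ → Submodule K A) (i : ℕ) : Submodule K A := ⨆ j, ⨆ (_ : j < i), F j

/-- The piece `Fᵢ / Fᵢ₋₁` of the associated graded algebra. -/
def GrPiece (F : ℕ → Submodule K A) (i : ℕ) : Type v :=
  (F i) ⧸ (below F i).comap (F i).subtype

instance grPieceAddCommGroup (F : ℕ → Submodule K A) (i : ℕ) : AddCommGroup (GrPiece F i) :=
  inferInstanceAs (AddCommGroup ((F i) ⧸ (below F i).comap (F i).subtype))

instance grPieceModule (F : ℕ → Submodule K A) (i : ℕ) : Module K (GrPiece F i) :=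
  inferInstanceAs (Module K ((F i) ⧸ (below F i).comap (F i).subtype))

/-- The class in `Fᵢ / Fᵢ₋₁` of an element of `Fᵢ`. -/
def grMk (F : ℕ → Submodule K A) (i : ℕ) : F i →ₗ[K] GrPiece F i :=
  Submodule.mkQ ((below F i).comap (F i).subtype)

variable (F : ℕ → Submodule K A)

theorem grMk_surjective (i : ℕ) : Function.Surjective (grMk F i) :=
  Submodule.mkQ_surjective ((below F i).comap (F i).subtype)

theorem grMk_eq_zero {i : ℕ} (a : F i) : grMk F i a = 0 ↔ (a : A) ∈ below F i := by
  exact Submodule.Quotient.mk_eq_zero ((below F i).comap (F i).subtype)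

/-- A linear map on `Fᵢ` which vanishes on `Fᵢ₋₁` induces a linear map on `Fᵢ / Fᵢ₋₁`. -/
def grLift {N : Type*} [AddCommGroup N] [Module K N] {i : ℕ} (f : F i →ₗ[K] N)
    (hf : ∀ a : F i, (a : A) ∈ below F i → f a = 0) : GrPiece F i →ₗ[K] N :=
  Submodule.liftQ ((below F i).comap (F i).subtype) f (fun a ha => hf a ha)

theorem le_below {i j : ℕ} (h : j < i) : F j ≤ below F i := le_iSup₂_of_le j h le_rfl

theorem gradedMk_congr {i j : ℕ} (h : i = j) (a : F i) (b : F j) (hab : (a : A) = b) :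
    (GradedMonoid.mk i (grMk F i a) : GradedMonoid (GrPiece F)) =
      GradedMonoid.mk j (grMk F j b) := by
  subst h
  rw [Subtype.ext hab]

variable [SetLike.GradedMonoid F]

theorem mul_mem_below_right {i j : ℕ} {a b : A} (ha : a ∈ F i) (hb : b ∈ below F j) :
    a * b ∈ below F (i + j) := by
  have h : below F j ≤ (below F (i + j)).comap (LinearMap.mulLeft K a) := by
    refine iSup₂_le fun k hk c hc => ?_
    exact le_below F (by omega) (SetLike.mul_mem_graded ha hc)
  exact h hb

theorem mul_mem_below_left {i j : ℕ} {a b : A} (ha : a ∈ below F i) (hb : b ∈ F j) :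
    a * b ∈ below F (i + j) := by
  have h : below F i ≤ (below F (i + j)).comap (LinearMap.mulRight K b) := by
    refine iSup₂_le fun k hk c hc => ?_
    exact le_below F (by omega) (SetLike.mul_mem_graded hc hb)
  exact h ha

/-- Multiplication of representatives, `Fᵢ × Fⱼ → Fᵢ₊ⱼ / Fᵢ₊ⱼ₋₁`. -/
def grMulAux (i j : ℕ) : F i →ₗ[K] F j →ₗ[K] GrPiece F (i + j) :=
  LinearMap.mk₂ K (fun a b => grMk F (i + j) ⟨a * b, SetLike.mul_mem_graded a.2 b.2⟩)
    (fun a a' b => by rw [← map_add]; congr 1; ext; simp [add_mul])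
    (fun c a b => by rw [← map_smul]; congr 1; ext; simp)
    (fun a b b' => by rw [← map_add]; congr 1; ext; simp [mul_add])
    (fun c a b => by rw [← map_smul]; congr 1; ext; simp)

/-- The product `(Fᵢ / Fᵢ₋₁) × (Fⱼ / Fⱼ₋₁) → Fᵢ₊ⱼ / Fᵢ₊ⱼ₋₁` induced by the product of `A`. -/
def grMul (i j : ℕ) : GrPiece F i →ₗ[K] GrPiece F j →ₗ[K] GrPiece F (i + j) :=
  grLift F (grLift F (grMulAux F i j).flip (by
      intro b hb
      ext a
      exact (grMk_eq_zero F _).2 (mul_mem_below_right F a.2 hb))).flip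
    (by
      intro a ha
      ext b
      obtain ⟨b, rfl⟩ := grMk_surjective F j b
      exact (grMk_eq_zero F _).2 (mul_mem_below_left F ha b.2))

theorem grMul_mk {i j : ℕ} (a : F i) (b : F j) :
    grMul F i j (grMk F i a) (grMk F j b) =
      grMk F (i + j) ⟨a * b, SetLike.mul_mem_graded a.2 b.2⟩ := rfl

instance grGOne : GradedMonoid.GOne (GrPiece F) where
  one := grMk F 0 ⟨1, SetLike.one_mem_graded F⟩

instance grGMul : GradedMonoid.GMul (GrPiece F) where
  mul {i j} a b := grMul F i j a b

instance grGMonoid : GradedMonoid.GMonoid (GrPiece F) where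
  one_mul := by
    rintro ⟨i, a⟩
    obtain ⟨a, rfl⟩ := grMk_surjective F i a
    exact gradedMk_congr F (zero_add i) _ _ (one_mul _)
  mul_one := by
    rintro ⟨i, a⟩
    obtain ⟨a, rfl⟩ := grMk_surjective F i a
    exact gradedMk_congr F (add_zero i) _ _ (mul_one _)
  mul_assoc := by
    rintro ⟨i, a⟩ ⟨j, b⟩ ⟨k, c⟩
    obtain ⟨a, rfl⟩ := grMk_surjective F i a
    obtain ⟨b, rfl⟩ := grMk_surjective F j b
    obtain ⟨c, rfl⟩ := grMk_surjective F k c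
    exact gradedMk_congr F (add_assoc i j k) _ _ (mul_assoc _ _ _)

instance grGRing : DirectSum.GRing (GrPiece F) where
  __ := grGMonoid F
  mul_zero {i j} a := map_zero (grMul F i j a)
  zero_mul {i j} b := LinearMap.map_zero₂ (grMul F i j) b
  mul_add {i j} a b c := map_add (grMul F i j a) b c
  add_mul {i j} a b c := LinearMap.map_add₂ (grMul F i j) a b c
  natCast m := m • grMk F 0 ⟨1, SetLike.one_mem_graded F⟩
  natCast_zero := zero_smul _ _
  natCast_succ m := succ_nsmul _ m
  intCast m := m • grMk F 0 ⟨1, SetLike.one_mem_graded F⟩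
  intCast_ofNat m := natCast_zsmul _ m
  intCast_negSucc_ofNat m := negSucc_zsmul _ m

instance grGAlgebra : DirectSum.GAlgebra K (GrPiece F) where
  toFun := ((LinearMap.id : K →ₗ[K] K).smulRight
    (grMk F 0 ⟨1, SetLike.one_mem_graded F⟩)).toAddMonoidHom
  map_one := one_smul K (grMk F 0 ⟨1, SetLike.one_mem_graded F⟩)
  map_mul r s := gradedMk_congr F (zero_add 0).symm
    ((r * s) • ⟨1, SetLike.one_mem_graded F⟩) _ (by simp [mul_smul, smul_comm r s])
  commutes := by
    rintro r ⟨i, a⟩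
    obtain ⟨a, rfl⟩ := grMk_surjective F i a
    exact gradedMk_congr F ((zero_add i).trans (add_zero i).symm) _ _ (by simp)
  smul_def := by
    rintro r ⟨i, a⟩
    obtain ⟨a, rfl⟩ := grMk_surjective F i a
    exact gradedMk_congr F (zero_add i).symm (r • a) _ (by simp)

/-- The associated graded algebra `Gr(A) = ⨁ᵢ Fᵢ / Fᵢ₋₁`. -/
abbrev Gr : Type v := ⨁ i, GrPiece F i

end AssociatedGraded

/-! ### Quadratic algebras and their PBW deformations

`V` is a vector space, `T(V) = ⨁ⱼ Tʲ(V)` its tensor algebra. -/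

section Quadratic

variable (K : Type u) [Field K] (V : Type v) [AddCommGroup V] [Module K V]

/-- The homogeneous component `Tʲ(V)` of the tensor algebra. -/
def tensorDegree (j : ℕ) : Submodule K (TensorAlgebra K V) :=
  LinearMap.range (TensorAlgebra.ι K : V →ₗ[K] TensorAlgebra K V) ^ j

instance tensorDegree_gradedAlgebra : GradedAlgebra (tensorDegree K V) :=
  TensorAlgebra.gradedAlgebra

/-- The filtration `Fᵢ(T) = ⨁_{j ≤ i} Tʲ(V)`. -/
def tensorFiltration (i : ℕ) : Submodule K (TensorAlgebra K V) :=
  ⨆ j, ⨆ (_ : j ≤ i), tensorDegree K V j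

variable {K V}

/-- The algebra `T(V) / ⟨P⟩`, where `⟨P⟩` is the two-sided ideal generated by `P`. -/
abbrev TensorQuotient (P : Submodule K (TensorAlgebra K V)) : Type (max u v) :=
  TensorAlgebra K V ⧸ (TwoSidedIdeal.span (P : Set (TensorAlgebra K V))).asIdeal

/-- The quotient map `T(V) → T(V) / ⟨P⟩`. -/
def toQuotient (P : Submodule K (TensorAlgebra K V)) :
    TensorAlgebra K V →ₐ[K] TensorQuotient P :=
  Ideal.Quotient.mkₐ K _

/-- The class in `T(V) / ⟨P⟩` of a vector. -/
def generator (P : Submodule K (TensorAlgebra K V)) (v : V) : TensorQuotient P :=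
  toQuotient P (TensorAlgebra.ι K v)

/-- The filtration of `T(V) / ⟨P⟩` inherited from `T(V)`. -/
def quotientFiltration (P : Submodule K (TensorAlgebra K V)) (i : ℕ) :
    Submodule K (TensorQuotient P) :=
  (tensorFiltration K V i).map (toQuotient P).toLinearMap

/-- The image of `Tⁱ(V)` in `T(V) / ⟨R⟩`. If `R ⊆ V ⊗ V`, these are the homogeneous components of
the graded algebra `T(V) / ⟨R⟩`. -/
def quotientDegree (R : Submodule K (TensorAlgebra K V)) (i : ℕ) :
    Submodule K (TensorQuotient R) :=
  (tensorDegree K V i).map (toQuotient R).toLinearMap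

/-- The space `R = π(P)`, where `π` is the projection onto `T²(V) = V ⊗ V`. -/
def quadraticPart (P : Submodule K (TensorAlgebra K V)) : Submodule K (TensorAlgebra K V) :=
  P.map (GradedAlgebra.proj (tensorDegree K V) 2)

theorem tensorDegree_le_filtration {i j : ℕ} (h : j ≤ i) :
    tensorDegree K V j ≤ tensorFiltration K V i :=
  le_iSup₂_of_le j h le_rfl

instance tensorFiltration_gradedMonoid : SetLike.GradedMonoid (tensorFiltration K V) where
  one_mem := tensorDegree_le_filtration le_rfl (SetLike.one_mem_graded (tensorDegree K V))
  mul_mem {i j} a b ha hb := by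
    have h : tensorFiltration K V i * tensorFiltration K V j ≤ tensorFiltration K V (i + j) := by
      simp only [tensorFiltration, Submodule.iSup_mul, Submodule.mul_iSup]
      refine iSup₂_le fun k hk => iSup₂_le fun l hl => ?_
      refine le_trans ?_ (tensorDegree_le_filtration (by omega : l + k ≤ i + j))
      rw [tensorDegree, tensorDegree, tensorDegree, pow_add]
    exact h (Submodule.mul_mem_mul ha hb)

instance quotientFiltration_gradedMonoid (P : Submodule K (TensorAlgebra K V)) :
    SetLike.GradedMonoid (quotientFiltration P) where
  one_mem := ⟨1, SetLike.one_mem_graded (tensorFiltration K V), map_one (toQuotient P)⟩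
  mul_mem := by
    rintro i j _ _ ⟨a, ha, rfl⟩ ⟨b, hb, rfl⟩
    exact ⟨a * b, SetLike.mul_mem_graded ha hb, map_mul (toQuotient P) a b⟩

/-- The algebra homomorphism `T(V) → Gr(A)`, `A = T(V) / ⟨P⟩`, which sends `v` to the class of `v`
in `A₁ / A₀`. -/
def toGr (P : Submodule K (TensorAlgebra K V)) :
    TensorAlgebra K V →ₐ[K] Gr (quotientFiltration P) :=
  TensorAlgebra.lift K
    (DirectSum.lof K ℕ (GrPiece (quotientFiltration P)) 1 ∘ₗ grMk (quotientFiltration P) 1 ∘ₗ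
      ((toQuotient P).toLinearMap ∘ₗ TensorAlgebra.ι K).codRestrict (quotientFiltration P 1)
        (fun v => ⟨TensorAlgebra.ι K v, tensorDegree_le_filtration le_rfl
          (by rw [tensorDegree, pow_one]; exact ⟨v, rfl⟩), rfl⟩))

theorem toQuotient_mem (P : Submodule K (TensorAlgebra K V)) {i : ℕ} {t : TensorAlgebra K V}
    (ht : t ∈ tensorDegree K V i) : toQuotient P t ∈ quotientFiltration P i :=
  ⟨t, tensorDegree_le_filtration le_rfl ht, rfl⟩

/-- On `Tⁱ(V)` the homomorphism `toGr P` is induced by the projection `T(V) → A`. -/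
theorem toGr_of_mem (P : Submodule K (TensorAlgebra K V)) {i : ℕ} {t : TensorAlgebra K V}
    (ht : t ∈ tensorDegree K V i) :
    toGr P t = DirectSum.of (GrPiece (quotientFiltration P)) i
      (grMk (quotientFiltration P) i ⟨toQuotient P t, toQuotient_mem P ht⟩) := by
  induction ht using Submodule.pow_induction_on_left' with
  | algebraMap r =>
    rw [AlgHom.commutes, DirectSum.algebraMap_apply]
    refine congrArg _ ((map_smul (grMk (quotientFiltration P) 0) r _).symm.trans (congrArg _ ?_))
    ext
    simp [Algebra.algebraMap_eq_smul_one]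
  | add x y i hx hy ihx ihy =>
    rw [map_add, ihx, ihy, ← map_add, ← map_add]
    exact congrArg _ (congrArg _ (Subtype.ext (map_add (toQuotient P) x y).symm))
  | mem_mul m hm i x hx ih =>
    obtain ⟨v, rfl⟩ := hm
    rw [map_mul, ih, toGr, TensorAlgebra.lift_ι_apply]
    refine (DirectSum.of_mul_of _ _).trans (DirectSum.of_eq_of_gradedMonoid_eq ?_)
    exact gradedMk_congr (quotientFiltration P) (add_comm 1 i) _ _
      (map_mul (toQuotient P) (TensorAlgebra.ι K v) x).symm

theorem toGr_eq_zero (P : Submodule K (TensorAlgebra K V)) (hP : P ≤ tensorFiltration K V 2)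
    {r : TensorAlgebra K V} (hr : r ∈ quadraticPart P) : toGr P r = 0 := by
  obtain ⟨q, hq, rfl⟩ := hr
  have h1 : ∀ t ∈ tensorFiltration K V 2,
      GradedAlgebra.proj (tensorDegree K V) 2 t - t ∈ tensorFiltration K V 1 := by
    have h : tensorFiltration K V 2 ≤ (tensorFiltration K V 1).comap
        (GradedAlgebra.proj (tensorDegree K V) 2 - LinearMap.id) := by
      refine iSup₂_le fun j hj t ht => ?_
      rw [Submodule.mem_comap, LinearMap.sub_apply, LinearMap.id_apply, GradedAlgebra.proj_apply]
      rcases hj.eq_or_lt with rfl | hj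
      · rw [DirectSum.decompose_of_mem_same _ ht, sub_self]
        exact zero_mem _
      · rw [DirectSum.decompose_of_mem_ne _ ht hj.ne, zero_sub]
        exact neg_mem (tensorDegree_le_filtration (by omega) ht)
    exact fun t ht => h ht
  have h2 : GradedAlgebra.proj (tensorDegree K V) 2 q ∈ tensorDegree K V 2 := by
    rw [GradedAlgebra.proj_apply]
    exact SetLike.coe_mem _
  have h3 : toQuotient P q = 0 :=
    Ideal.Quotient.eq_zero_iff_mem.2 (TwoSidedIdeal.subset_span hq)
  rw [toGr_of_mem P h2, (grMk_eq_zero (quotientFiltration P) _).2, map_zero]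
  refine le_below (quotientFiltration P) one_lt_two ⟨_, h1 q (hP hq), ?_⟩
  simp [h3]

/-- The natural homomorphism `p : T(V) / ⟨R⟩ → Gr(A)`, where `A = T(V) / ⟨P⟩` and `R = π(P)`. -/
def naturalMap (P : Submodule K (TensorAlgebra K V)) (hP : P ≤ tensorFiltration K V 2) :
    TensorQuotient (quadraticPart P) →ₐ[K] Gr (quotientFiltration P) :=
  Ideal.Quotient.liftₐ _ (toGr P) (by
    intro a ha
    have h : TwoSidedIdeal.span (quadraticPart P : Set (TensorAlgebra K V)) ≤
        TwoSidedIdeal.ker (toGr P) :=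
      TwoSidedIdeal.span_le.2 fun r hr => (TwoSidedIdeal.mem_ker _).2 (toGr_eq_zero P hP hr)
    exact (TwoSidedIdeal.mem_ker _).1 (h ha))

/-- `A = T(V) / ⟨P⟩` (with `P ⊆ F₂(T)`) is a PBW deformation of `B = T(V) / ⟨π(P)⟩`: the natural
homomorphism `B → Gr(A)` is an isomorphism. -/
def IsPBWDeformation (P : Submodule K (TensorAlgebra K V)) : Prop :=
  ∃ hP : P ≤ tensorFiltration K V 2, Function.Bijective (naturalMap P hP)

end Quadratic

/-! ### Homogeneous Koszul algebras -/

section Koszul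

/-- A linear free resolution `⋯ → P₂ → P₁ → P₀ → K → 0` over the graded algebra
`B = ⨁ₖ 𝓑ₖ` with augmentation `ε : B → K`. The module `Pᵢ` is the graded free left `B`-module on a
set `gen i` of generators of degree `i`, so that an element of `gen i →₀ B` is homogeneous of
degree `k + i` when all its coordinates lie in `𝓑ₖ`. The `B`-module structure of `K` is given by
`ε`, so a `B`-linear map to `K` is an `ε`-semilinear one; it automatically vanishes on positive
degrees when `ε` does. -/
structure LinearFreeResolution {K : Type u} [Field K] {B : Type w} [Ring B] [Algebra K B]
    (𝓑 : ℕ → Submodule K B) (ε : B →ₐ[K] K) where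
  gen : ℕ → Type w
  d : ∀ i, (gen (i + 1) →₀ B) →ₗ[B] (gen i →₀ B)
  aug : (gen 0 →₀ B) →ₛₗ[(ε : B →+* K)] K
  /-- The differentials preserve the degree: degree `k + (i + 1)` is degree `(k + 1) + i`. -/
  d_degree : ∀ (i k : ℕ) (p : gen (i + 1) →₀ B), (∀ s, p s ∈ 𝓑 k) → ∀ t, d i p t ∈ 𝓑 (k + 1)
  aug_surjective : Function.Surjective aug
  exact_zero : Function.Exact (d 0) aug
  exact_succ : ∀ i, Function.Exact (d (i + 1)) (d i)

variable {K : Type u} [Field K] {V : Type v} [AddCommGroup V] [Module K V]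

theorem algebraMapInv_eq_zero {j : ℕ} (hj : j ≠ 0) {t : TensorAlgebra K V}
    (ht : t ∈ tensorDegree K V j) : TensorAlgebra.algebraMapInv (R := K) t = 0 := by
  obtain ⟨j, rfl⟩ := Nat.exists_eq_succ_of_ne_zero hj
  rw [tensorDegree, pow_succ'] at ht
  induction ht using Submodule.mul_induction_on' with
  | mem_mul_mem m hm x hx =>
    obtain ⟨v, rfl⟩ := hm
    simp [TensorAlgebra.algebraMapInv]
  | add x hx y hy ihx ihy => rw [map_add, ihx, ihy, add_zero]

/-- The augmentation `T(V) / ⟨R⟩ → K`, `v ↦ 0`, of a homogeneous quadratic algebra. -/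
def augmentation (R : Submodule K (TensorAlgebra K V)) (hR : R ≤ tensorDegree K V 2) :
    TensorQuotient R →ₐ[K] K :=
  Ideal.Quotient.liftₐ _ TensorAlgebra.algebraMapInv (by
    intro a ha
    have h : TwoSidedIdeal.span (R : Set (TensorAlgebra K V)) ≤
        TwoSidedIdeal.ker (TensorAlgebra.algebraMapInv (R := K) (M := V)) :=
      TwoSidedIdeal.span_le.2 fun r hr =>
        (TwoSidedIdeal.mem_ker _).2 (algebraMapInv_eq_zero two_ne_zero (hR hr))
    exact (TwoSidedIdeal.mem_ker _).1 (h ha))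

/-- `T(V) / ⟨R⟩` is a homogeneous Koszul algebra: it is homogeneous pre-Koszul (finitely many
generators, and quadratic forms `R ⊆ V ⊗ V` as relations), and the trivial module `K` has a linear
free resolution. -/
def IsHomogeneousKoszul (R : Submodule K (TensorAlgebra K V)) : Prop :=
  Module.Finite K V ∧ ∃ hR : R ≤ tensorDegree K V 2,
    Nonempty (LinearFreeResolution (quotientDegree R) (augmentation R hR))

end Koszul

end PBWKoszul

end

noncomputable section

namespace PBWKoszul

/-! ### Standard monomials in skew-commuting variables -/

section StdMonomial

/-! The lower terms in the commutation relations vanish for degree reasons. Since `R` is purely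
quadratic, `B` maps onto the trivial square zero extension of `K` by the coordinate space `Fin n →
K`, with each generator going to a coordinate vector. All products of generators die there, while
constants and linear terms survive, so the relation must read `x j * x i = c i j • (x i * x j)`
(`exists_mul_generator_eq_smul`). Scalars are central in a `K`-algebra, and semi-commutativity
follows.

These relations generate `⟨R⟩`: in degree two, skew commutation rewrites every product as a multiple
of an ordered one, and ordered products are linearly independent in `B`. A quadratic tensor that
vanishes in `B` therefore already vanishes modulo the skew relations
(`map_eq_zero_of_skew_commuting`).

Koszulness comes from a twisted Koszul complex with basis `e S`, `S ⊆ {1, …, n}`. Its differential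
sends `e S` to the sum over `s ∈ S` of `x s • e (S \ {s})`, weighted by the cost of moving `e s` to
the right end: a factor `-c s u` for each `u ∈ S` beyond `s`. These weights give `d² = 0`
(`koszulD_comp_self`). Exactness follows from a `K`-linear contracting homotopy on the basis `x ^ α
• e S`: the largest index occurring in `α` or `S` is moved from `α` into `S`, with value zero if it
already lies in `S` (`koszul_homotopy`). The signs and degrees are handled on the sum of all terms,
which is then cut by cardinality to give `koszulResolution`. -/

theorem stdMonomial_zero {A : Type*} [Ring A] {n : ℕ} (x : Fin n → A) : stdMonomial x 0 = 1 := by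
  simp [stdMonomial, List.ofFn_const]

theorem stdMonomial_succ {A : Type*} [Ring A] {n : ℕ} (x : Fin (n + 1) → A)
    (α : Fin (n + 1) → ℕ) :
    stdMonomial x α =
      x 0 ^ α 0 * stdMonomial (fun i => x i.succ) (fun i => α i.succ) := by
  simp [stdMonomial, List.ofFn_succ]

theorem map_stdMonomial {A A' F : Type*} [Ring A] [Ring A'] [FunLike F A A']
    [RingHomClass F A A'] (f : F) {n : ℕ} (x : Fin n → A) (α : Fin n → ℕ) :
    f (stdMonomial x α) = stdMonomial (fun i => f (x i)) α := by
  simp [stdMonomial, map_list_prod, List.map_ofFn, Function.comp_def]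

/-- No variable after `x m` occurs, so the new factor is already in place: no commutation is needed
and no scalar appears. -/
theorem stdMonomial_mul_of_forall_lt {A : Type*} [Ring A] {n : ℕ} (x : Fin n → A)
    (α : Fin n → ℕ) (m : Fin n) (hm : ∀ u, m < u → α u = 0) :
    stdMonomial x α * x m = stdMonomial x (α + Pi.single m 1) := by
  induction n with
  | zero => exact m.elim0
  | succ n ih =>
    rw [stdMonomial_succ, stdMonomial_succ]
    induction m using Fin.cases with
    | zero =>
      have h1 : (fun i : Fin n => α i.succ) = 0 := funext fun i => hm _ i.succ_pos
      have h2 : (fun i : Fin n => (α + Pi.single 0 1 : Fin (n + 1) → ℕ) i.succ) = 0 :=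
        funext fun i => by simp [hm _ i.succ_pos, Fin.succ_ne_zero]
      rw [h1, h2]
      simp [stdMonomial_zero, pow_succ]
    | succ m =>
      have h := ih (fun i => x i.succ) (fun i => α i.succ) m
        (fun u hu => hm _ (Fin.succ_lt_succ_iff.2 hu))
      have h2 : (fun i : Fin n => (α + Pi.single m.succ 1 : Fin (n + 1) → ℕ) i.succ) =
          (fun i => α i.succ) + Pi.single m 1 := by
        funext i
        simp [Pi.single_apply, Fin.succ_inj]
      rw [mul_assoc, h, h2]
      simp [(Fin.succ_ne_zero m).symm]

variable {K B : Type*} [Field K] [Ring B] [Algebra K B]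

/-- The elements which commute with `y` up to a scalar. -/
def scalarCommuting (K : Type*) {B : Type*} [Field K] [Ring B] [Algebra K B] (y : B) :
    Submonoid B where
  carrier := {a | ∃ μ : K, a * y = μ • (y * a)}
  one_mem' := ⟨1, by simp⟩
  mul_mem' := by
    rintro a b ⟨μ, hμ⟩ ⟨ν, hν⟩
    refine ⟨ν * μ, ?_⟩
    rw [mul_assoc, hν, mul_smul_comm, ← mul_assoc, hμ, smul_mul_assoc, smul_smul, mul_assoc]

/-- Moving `x s` left past the later variables costs only scalars. The value of `μ` is irrelevant:
in the homotopy identity it either multiplies zero or occurs in two cancelling terms. -/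
theorem exists_stdMonomial_mul {n : ℕ} (x : Fin n → B) (c : Fin n → Fin n → K)
    (hc : ∀ i j, x j * x i = c i j • (x i * x j)) (α : Fin n → ℕ) (s : Fin n) :
    ∃ μ : K, stdMonomial x α * x s = μ • stdMonomial x (α + Pi.single s 1) := by
  induction n with
  | zero => exact s.elim0
  | succ n ih =>
    rw [stdMonomial_succ, stdMonomial_succ]
    induction s using Fin.cases with
    | zero =>
      have h2 : (fun i : Fin n => (α + Pi.single 0 1 : Fin (n + 1) → ℕ) i.succ) =
          fun i => α i.succ :=
        funext fun i => by simp [Fin.succ_ne_zero]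
      -- The tail is a product of powers of variables that each commute with `x 0` up to a scalar,
      -- and such elements form a submonoid.
      have h : stdMonomial (fun i => x i.succ) (fun i => α i.succ) ∈
          scalarCommuting K (x 0) := by
        refine Submonoid.list_prod_mem _ fun a ha => ?_
        obtain ⟨i, rfl⟩ := (List.mem_ofFn' _ _).1 ha
        exact pow_mem (show x i.succ ∈ scalarCommuting K (x 0) from ⟨_, hc _ _⟩) _
      obtain ⟨μ, hμ⟩ := h
      refine ⟨μ, ?_⟩
      rw [h2, mul_assoc, hμ, mul_smul_comm, ← mul_assoc]
      simp [pow_succ]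
    | succ m =>
      obtain ⟨μ, h⟩ := ih (fun i => x i.succ) (fun i j => c i.succ j.succ)
        (fun i j => hc _ _) (fun i => α i.succ) m
      refine ⟨μ, ?_⟩
      have h2 : (fun i : Fin n => (α + Pi.single m.succ 1 : Fin (n + 1) → ℕ) i.succ) =
          (fun i => α i.succ) + Pi.single m 1 := by
        funext i
        simp [Pi.single_apply, Fin.succ_inj]
      rw [mul_assoc, h, h2]
      simp [(Fin.succ_ne_zero m).symm]

end StdMonomial

/-! ### The Koszul complex of a skew polynomial algebra -/

section KoszulComplex

variable {K B : Type*} [Field K] [Ring B] [Algebra K B] {n : ℕ}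
variable (x : Fin n → B) (c : Fin n → Fin n → K)

/-- The coefficient of `x s • e (S \ {s})` in the differential of `e S`. -/
def koszulCoeff (S : Finset (Fin n)) (s : Fin n) : K := ∏ u ∈ S with s < u, -c s u

/-- The differential of the Koszul complex, on the direct sum of all of its terms. -/
def koszulD : (Finset (Fin n) →₀ B) →ₗ[B] (Finset (Fin n) →₀ B) :=
  Finsupp.linearCombination B fun S =>
    ∑ s ∈ S, Finsupp.single (S.erase s) (koszulCoeff c S s • x s)

theorem koszulD_single (S : Finset (Fin n)) (b : B) :
    koszulD x c (Finsupp.single S b) =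
      ∑ s ∈ S, koszulCoeff c S s • Finsupp.single (S.erase s) (b * x s) := by
  rw [koszulD, Finsupp.linearCombination_single, Finset.smul_sum]
  refine Finset.sum_congr rfl fun s _ => ?_
  rw [Finsupp.smul_single, smul_eq_mul, mul_smul_comm, Finsupp.smul_single]

/-- The coefficient at `t` only sees indices beyond `t`, so removing a smaller one changes nothing.
-/
theorem koszulCoeff_erase_of_lt (S : Finset (Fin n)) {s t : Fin n} (h : s < t) :
    koszulCoeff c (S.erase s) t = koszulCoeff c S t := by
  unfold koszulCoeff
  refine Finset.prod_congr ?_ fun _ _ => rfl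
  ext u
  simp only [Finset.mem_filter, Finset.mem_erase]
  exact ⟨fun hu => ⟨hu.1.2, hu.2⟩, fun hu => ⟨⟨(h.trans hu.2).ne', hu.1⟩, hu.2⟩⟩

theorem koszulCoeff_insert (S : Finset (Fin n)) {s m : Fin n} (h : s < m) (hm : m ∉ S) :
    koszulCoeff c (insert m S) s = -c s m * koszulCoeff c S s := by
  unfold koszulCoeff
  rw [Finset.filter_insert, if_pos h, Finset.prod_insert (by simp [hm])]

theorem koszulCoeff_of_forall_le (S : Finset (Fin n)) {m : Fin n} (h : ∀ u ∈ S, u ≤ m) :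
    koszulCoeff c S m = 1 := by
  unfold koszulCoeff
  rw [Finset.filter_eq_empty_iff.2 fun u hu => (h u hu).not_gt, Finset.prod_empty]

/-- For `s < t`, the two orders of removing `s` and `t` cancel: the presence of `t` gives the
coefficient of `s` an extra factor `-c s t`, which offsets the `c s t` from reordering `x t * x s`.
-/
theorem koszulD_comp_self (hc : ∀ i j, x j * x i = c i j • (x i * x j)) :
    koszulD x c ∘ₗ koszulD x c = 0 := by
  ext S : 1
  ext : 1
  simp only [LinearMap.comp_apply, Finsupp.lsingle_apply, LinearMap.zero_apply, koszulD_single,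
    map_sum, LinearMap.map_smul_of_tower, Finset.smul_sum, one_mul]
  have key : ∀ s t, s ∈ S → t ∈ S → s < t →
      koszulCoeff c S s • koszulCoeff c (S.erase s) t •
          Finsupp.single ((S.erase s).erase t) (x s * x t) +
        koszulCoeff c S t • koszulCoeff c (S.erase t) s •
          Finsupp.single ((S.erase t).erase s) (x t * x s) = 0 := by
    intro s t _ ht h
    have h1 : koszulCoeff c S s = -c s t * koszulCoeff c (S.erase t) s := by
      conv_lhs => rw [← Finset.insert_erase ht]
      rw [koszulCoeff_insert c _ h (Finset.notMem_erase _ _)]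
    rw [koszulCoeff_erase_of_lt c S h, h1, hc s t, Finset.erase_right_comm]
    simp only [← Finsupp.smul_single, smul_smul, ← add_smul]
    rw [show -c s t * koszulCoeff c (S.erase t) s * koszulCoeff c S t +
      koszulCoeff c S t * (koszulCoeff c (S.erase t) s * c s t) = 0 by ring, zero_smul]
  rw [Finset.sum_sigma']
  -- The involution swaps the order in which the two indices are removed.
  refine Finset.sum_involution (fun p _ => ⟨p.2, p.1⟩) ?_ ?_ ?_ ?_
  · rintro ⟨s, t⟩ h
    simp only [Finset.mem_sigma, Finset.mem_erase] at h
    rcases lt_or_gt_of_ne h.2.1 with h' | h'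
    · rw [add_comm]
      exact key t s h.2.2 h.1 h'
    · exact key s t h.1 h.2.2 h'
  · rintro ⟨s, t⟩ h _ h'
    simp only [Finset.mem_sigma, Finset.mem_erase] at h
    exact h.2.1 (congrArg Sigma.fst h')
  · rintro ⟨s, t⟩ h
    simp only [Finset.mem_sigma, Finset.mem_erase] at h ⊢
    exact ⟨h.2.2, h.2.1.symm, h.1⟩
  · rintro ⟨s, t⟩ _
    rfl

end KoszulComplex

/-! ### The contracting homotopy -/

section Homotopy

variable {K B : Type*} [Field K] [Ring B] [Algebra K B] {n : ℕ}

/-- The value at `x ^ α • e S` of the contracting homotopy of the Koszul complex. -/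
def koszulHAux (x : Fin n → B) (S : Finset (Fin n)) (α : Fin n → ℕ) : Finset (Fin n) →₀ B :=
  if h : (S ∪ Finset.univ.filter fun u => α u ≠ 0).Nonempty then
    if Finset.max' _ h ∈ S then 0
    else Finsupp.single (insert (Finset.max' _ h) S)
      -- The subtraction does not truncate: a maximum outside `S` lies in the support of `α`.
      (stdMonomial x (α - Pi.single (Finset.max' _ h) 1))
  else 0

theorem koszulHAux_empty (x : Fin n → B) : koszulHAux x ∅ 0 = 0 := by
  simp [koszulHAux]

theorem koszulHAux_of_max_mem (x : Fin n → B) {S : Finset (Fin n)} {α : Fin n → ℕ} {m : Fin n}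
    (hm : m ∈ S) (hS : ∀ u ∈ S, u ≤ m) (hα : ∀ u, m < u → α u = 0) :
    koszulHAux x S α = 0 := by
  have hne : (S ∪ Finset.univ.filter fun u => α u ≠ 0).Nonempty :=
    ⟨m, Finset.mem_union_left _ hm⟩
  have hmax : Finset.max' _ hne = m := by
    refine le_antisymm (Finset.max'_le _ _ _ fun u hu => ?_)
      (Finset.le_max' _ _ (Finset.mem_union_left _ hm))
    rcases Finset.mem_union.1 hu with hu | hu
    · exact hS u hu
    · exact not_lt.1 fun h => (Finset.mem_filter.1 hu).2 (hα u h)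
  rw [koszulHAux, dif_pos hne, if_pos (by rw [hmax]; exact hm)]

theorem koszulHAux_of_max_notMem (x : Fin n → B) {S : Finset (Fin n)} {α : Fin n → ℕ}
    {m : Fin n} (hS : ∀ u ∈ S, u < m) (hα : ∀ u, m < u → α u = 0) :
    koszulHAux x S (α + Pi.single m 1) = Finsupp.single (insert m S) (stdMonomial x α) := by
  have hmem : m ∈ S ∪ Finset.univ.filter fun u => (α + Pi.single m 1 : Fin n → ℕ) u ≠ 0 :=
    Finset.mem_union_right _ (by simp)
  have hne : (S ∪ Finset.univ.filter fun u => (α + Pi.single m 1 : Fin n → ℕ) u ≠ 0).Nonempty :=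
    ⟨m, hmem⟩
  have hmax : Finset.max' _ hne = m := by
    refine le_antisymm (Finset.max'_le _ _ _ fun u hu => ?_) (Finset.le_max' _ _ hmem)
    rcases Finset.mem_union.1 hu with hu | hu
    · exact (hS u hu).le
    · refine not_lt.1 fun h => (Finset.mem_filter.1 hu).2 ?_
      simp [hα u h, h.ne']
  rw [koszulHAux, dif_pos hne]
  simp only [hmax]
  rw [if_neg fun h => (hS m h).false, add_tsub_cancel_right]

variable (b : Module.Basis (Fin n → ℕ) K B) (x : Fin n → B) (c : Fin n → Fin n → K)

/-- The contracting homotopy of the Koszul complex. -/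
def koszulH : (Finset (Fin n) →₀ B) →ₗ[K] (Finset (Fin n) →₀ B) :=
  (Finsupp.basis fun _ : Finset (Fin n) => b).constr K fun p => koszulHAux x p.1 p.2

theorem koszulH_single (hb : ∀ α, b α = stdMonomial x α) (S : Finset (Fin n)) (α : Fin n → ℕ) :
    koszulH b x (Finsupp.single S (stdMonomial x α)) = koszulHAux x S α := by
  have h := (Finsupp.basis fun _ : Finset (Fin n) => b).constr_basis K
    (fun p => koszulHAux x p.1 p.2) ⟨S, α⟩
  simpa only [koszulH, Finsupp.coe_basis, hb] using h

/-- The projection of the Koszul complex onto the degree zero part of its zeroth term. -/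
def koszulE (ε : B →ₐ[K] K) : (Finset (Fin n) →₀ B) →ₗ[K] (Finset (Fin n) →₀ B) :=
  Finsupp.lsingle ∅ ∘ₗ Algebra.linearMap K B ∘ₗ ε.toLinearMap ∘ₗ Finsupp.lapply ∅

theorem koszulE_apply (ε : B →ₐ[K] K) (z : Finset (Fin n) →₀ B) :
    koszulE ε z = Finsupp.single ∅ (algebraMap K B (ε (z ∅))) := rfl

theorem map_stdMonomial_eq_zero (ε : B →ₐ[K] K) (hε : ∀ i, ε (x i) = 0) {α : Fin n → ℕ}
    (hα : α ≠ 0) : ε (stdMonomial x α) = 0 := by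
  obtain ⟨i, hi⟩ := Function.ne_iff.1 hα
  rw [map_stdMonomial]
  refine List.prod_eq_zero ((List.mem_ofFn' _ _).2 ⟨i, ?_⟩)
  simp only [hε]
  exact zero_pow hi

/-- Let `m` be the largest index in `S` or in the support of `α`. If `m ∈ S`, the homotopy kills `x
^ α • e S`, and in its differential only the term removing `m` contributes, returning the original
element. If `m ∉ S`, the term of `d h` removing `m` returns it, and the others cancel against `h d`.
With no such `m`, the element is `1 • e ∅`, on which `koszulE` is the identity. -/
theorem koszul_homotopy_single (hb : ∀ α, b α = stdMonomial x α)
    (hc : ∀ i j, x j * x i = c i j • (x i * x j)) (ε : B →ₐ[K] K) (hε : ∀ i, ε (x i) = 0)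
    (S : Finset (Fin n)) (α : Fin n → ℕ) :
    koszulD x c (koszulHAux x S α) +
        koszulH b x (koszulD x c (Finsupp.single S (stdMonomial x α))) +
        koszulE ε (Finsupp.single S (stdMonomial x α)) =
      Finsupp.single S (stdMonomial x α) := by
  by_cases hne : (S ∪ Finset.univ.filter fun u => α u ≠ 0).Nonempty
  swap
  · rw [Finset.not_nonempty_iff_eq_empty, Finset.union_eq_empty] at hne
    obtain ⟨rfl, h⟩ := hne
    obtain rfl : α = 0 := funext fun u => by
      simpa using Finset.filter_eq_empty_iff.1 h (Finset.mem_univ u)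
    rw [koszulHAux_empty, koszulD_single, koszulE_apply]
    simp [stdMonomial_zero]
  have hE : koszulE ε (Finsupp.single S (stdMonomial x α)) = 0 := by
    rw [koszulE_apply]
    by_cases hS : S = ∅
    · subst hS
      have hα : α ≠ 0 := by
        rintro rfl
        simp at hne
      simp [map_stdMonomial_eq_zero x ε hε hα]
    · simp [hS]
  rw [hE, add_zero]
  obtain ⟨m, hm⟩ : ∃ m, m = Finset.max' _ hne := ⟨_, rfl⟩
  have hmem : m ∈ S ∪ Finset.univ.filter fun u => α u ≠ 0 := hm ▸ Finset.max'_mem _ hne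
  have hSm : ∀ u ∈ S, u ≤ m := fun u hu =>
    hm ▸ Finset.le_max' _ _ (Finset.mem_union_left _ hu)
  have hαm : ∀ u, m < u → α u = 0 := by
    intro u hu
    by_contra h
    exact hu.not_ge (hm ▸ Finset.le_max' _ _ (Finset.mem_union_right _ (by simpa using h)))
  clear hm
  by_cases hmS : m ∈ S
  · rw [koszulHAux_of_max_mem x hmS hSm hαm, map_zero, zero_add, koszulD_single, map_sum]
    have hαs : ∀ s ∈ S, ∀ u, m < u → (α + Pi.single s 1 : Fin n → ℕ) u = 0 := by
      intro s hs u hu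
      simp [hαm u hu, ((hSm s hs).trans_lt hu).ne']
    rw [Finset.sum_eq_single_of_mem m hmS]
    · rw [map_smul, koszulCoeff_of_forall_le c S hSm, one_smul,
        stdMonomial_mul_of_forall_lt x α m hαm, koszulH_single b x hb,
        koszulHAux_of_max_notMem x _ hαm, Finset.insert_erase hmS]
      intro u hu
      exact lt_of_le_of_ne (hSm u (Finset.mem_of_mem_erase hu)) (Finset.ne_of_mem_erase hu)
    -- After removing `s ≠ m`, the maximum `m` is still in the set, so the homotopy vanishes.
    · intro s hs hsm
      obtain ⟨μ, hμ⟩ := exists_stdMonomial_mul x c hc α s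
      rw [hμ, ← Finsupp.smul_single, map_smul, map_smul, koszulH_single b x hb,
        koszulHAux_of_max_mem x (Finset.mem_erase.2 ⟨hsm.symm, hmS⟩)
          (fun u hu => hSm u (Finset.mem_of_mem_erase hu)) (hαs s hs), smul_zero, smul_zero]
  · have hSlt : ∀ u ∈ S, u < m := fun u hu =>
      lt_of_le_of_ne (hSm u hu) fun h => hmS (h ▸ hu)
    have hα0 : α m ≠ 0 := by simpa [hmS] using hmem
    obtain ⟨β, rfl⟩ : ∃ β : Fin n → ℕ, α = β + Pi.single m 1 := by
      refine ⟨α - Pi.single m 1, (tsub_add_cancel_of_le fun u => ?_).symm⟩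
      by_cases hu : u = m
      · subst hu
        simpa using Nat.one_le_iff_ne_zero.2 hα0
      · simp [hu]
    have hβ : ∀ u, m < u → β u = 0 := fun u hu => by
      have := hαm u hu
      simp only [Pi.add_apply, Nat.add_eq_zero_iff] at this
      exact this.1
    rw [koszulHAux_of_max_notMem x hSlt hβ, koszulD_single, koszulD_single,
      Finset.sum_insert hmS, Finset.erase_insert hmS,
      koszulCoeff_of_forall_le c _ (by simpa using hSm), one_smul,
      stdMonomial_mul_of_forall_lt x β m hβ, add_assoc, map_sum, ← Finset.sum_add_distrib,
      Finset.sum_eq_zero, add_zero]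
    intro s hs
    have hsm := hSlt s hs
    obtain ⟨μ, hμ⟩ := exists_stdMonomial_mul x c hc β s
    have hβs : ∀ u, m < u → (β + Pi.single s 1 : Fin n → ℕ) u = 0 := fun u hu => by
      simp [hβ u hu, (hsm.trans hu).ne']
    -- Exchanging `x m` and `x s` gives `c s m`; moving `x s` into place gives the same `μ` as in
    -- the term of `d h`.
    have h : stdMonomial x (β + Pi.single m 1) * x s =
        (c s m * μ) • stdMonomial x (β + Pi.single s 1 + Pi.single m 1) := by
      rw [← stdMonomial_mul_of_forall_lt x β m hβ, mul_assoc, hc s m, mul_smul_comm,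
        ← mul_assoc, hμ, smul_mul_assoc, stdMonomial_mul_of_forall_lt x _ m hβs, smul_smul]
    rw [koszulCoeff_insert c S hsm hmS, h, hμ, ← Finsupp.smul_single, ← Finsupp.smul_single,
      map_smul, map_smul, koszulH_single b x hb,
      koszulHAux_of_max_notMem x (fun u hu => hSlt u (Finset.mem_of_mem_erase hu)) hβs,
      Finset.erase_insert_of_ne hsm.ne', smul_smul, smul_smul, ← add_smul]
    rw [show -c s m * koszulCoeff c S s * μ + koszulCoeff c S s * (c s m * μ) = 0 by ring,
      zero_smul]

theorem koszul_homotopy (hb : ∀ α, b α = stdMonomial x α)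
    (hc : ∀ i j, x j * x i = c i j • (x i * x j)) (ε : B →ₐ[K] K) (hε : ∀ i, ε (x i) = 0)
    (z : Finset (Fin n) →₀ B) :
    koszulD x c (koszulH b x z) + koszulH b x (koszulD x c z) + koszulE ε z = z := by
  have h : (koszulD x c).restrictScalars K ∘ₗ koszulH b x +
      koszulH b x ∘ₗ (koszulD x c).restrictScalars K + koszulE ε = LinearMap.id := by
    refine (Finsupp.basis fun _ : Finset (Fin n) => b).ext fun p => ?_
    rw [Finsupp.coe_basis]
    simp only [LinearMap.add_apply, LinearMap.comp_apply, LinearMap.restrictScalars_apply, hb,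
      LinearMap.id_apply]
    rw [koszulH_single b x hb]
    exact koszul_homotopy_single b x c hb hc ε hε p.1 p.2
  exact LinearMap.congr_fun h z

end Homotopy

/-! ### The Koszul resolution -/

section Resolution

universe u w

variable {K : Type u} {B : Type w} [Field K] [Ring B] [Algebra K B] {n : ℕ}

/-- The generators of the `i`-th term of the Koszul complex. -/
abbrev KoszulGen (n i : ℕ) : Type w := ULift.{w} {S : Finset (Fin n) // S.card = i}

/-- The set of indices given by a generator. -/
def KoszulGen.toFinset {n i : ℕ} (s : KoszulGen.{w} n i) : Finset (Fin n) := s.down.1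

theorem KoszulGen.toFinset_injective (n i : ℕ) :
    Function.Injective (KoszulGen.toFinset : KoszulGen.{w} n i → Finset (Fin n)) :=
  Subtype.val_injective.comp ULift.down_injective

variable (B) in
/-- The inclusion of the `i`-th term of the Koszul complex in the sum of all terms. -/
def koszulIncl (n i : ℕ) : (KoszulGen.{w} n i →₀ B) →ₗ[B] (Finset (Fin n) →₀ B) :=
  Finsupp.lmapDomain B B KoszulGen.toFinset

variable (B) in
/-- The projection to the `i`-th term of the Koszul complex. -/
def koszulProj (n i : ℕ) : (Finset (Fin n) →₀ B) →ₗ[B] (KoszulGen.{w} n i →₀ B) :=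
  Finsupp.lcomapDomain KoszulGen.toFinset (KoszulGen.toFinset_injective n i)

theorem koszulIncl_injective (n i : ℕ) : Function.Injective (koszulIncl B n i) :=
  Finsupp.mapDomain_injective (KoszulGen.toFinset_injective n i)

theorem koszulIncl_single (i : ℕ) (s : KoszulGen.{w} n i) (y : B) :
    koszulIncl B n i (Finsupp.single s y) = Finsupp.single s.toFinset y :=
  Finsupp.mapDomain_single

theorem koszulIncl_koszulProj (i : ℕ) {z : Finset (Fin n) →₀ B}
    (hz : z ∈ Finsupp.supported B B {S : Finset (Fin n) | S.card = i}) :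
    koszulIncl B n i (koszulProj B n i z) = z :=
  Finsupp.mapDomain_comapDomain _ (KoszulGen.toFinset_injective n i) z fun S hS =>
    ⟨⟨⟨S, (Finsupp.mem_supported B z).1 hz hS⟩⟩, rfl⟩

variable (b : Module.Basis (Fin n → ℕ) K B) (x : Fin n → B) (c : Fin n → Fin n → K)

theorem koszulD_single_mem (i : ℕ) (S : Finset (Fin n)) (hS : S.card = i + 1) (y : B) :
    koszulD x c (Finsupp.single S y) ∈
      Finsupp.supported B B {S : Finset (Fin n) | S.card = i} := by
  rw [koszulD_single]
  refine sum_mem fun s hs => Submodule.smul_of_tower_mem _ _ (Finsupp.single_mem_supported B _ ?_)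
  rw [Set.mem_ofPred_eq, Finset.card_erase_of_mem hs, hS, Nat.add_sub_cancel]

theorem koszulD_incl_mem (i : ℕ) (p : KoszulGen.{w} n (i + 1) →₀ B) :
    koszulD x c (koszulIncl B n (i + 1) p) ∈
      Finsupp.supported B B {S : Finset (Fin n) | S.card = i} := by
  induction p using Finsupp.induction_linear with
  | zero => simp
  | add p q hp hq =>
    rw [map_add, map_add]
    exact add_mem hp hq
  | single s y =>
    rw [koszulIncl_single]
    exact koszulD_single_mem x c i _ s.down.2 y

theorem koszulHAux_mem (S : Finset (Fin n)) (α : Fin n → ℕ) :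
    koszulHAux x S α ∈ Finsupp.supported B B {T : Finset (Fin n) | T.card = S.card + 1} := by
  rw [koszulHAux]
  split_ifs with h h'
  · exact zero_mem _
  · exact Finsupp.single_mem_supported B _ (Finset.card_insert_of_notMem h')
  · exact zero_mem _

theorem koszulH_incl_mem (hb : ∀ α, b α = stdMonomial x α) (i : ℕ)
    (p : KoszulGen.{w} n i →₀ B) :
    koszulH b x (koszulIncl B n i p) ∈
      Finsupp.supported B B {S : Finset (Fin n) | S.card = i + 1} := by
  induction p using Finsupp.induction_linear with
  | zero => simp
  | add p q hp hq =>
    rw [map_add, map_add]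
    exact add_mem hp hq
  | single s y =>
    rw [koszulIncl_single]
    -- The homotopy is only `K`-linear, so the coefficient `y` has to be expanded in standard
    -- monomials.
    induction b.mem_span y using Submodule.span_induction with
    | zero => simp
    | add y y' _ _ hy hy' =>
      rw [Finsupp.single_add, map_add]
      exact add_mem hy hy'
    | smul k y _ hy =>
      rw [← Finsupp.smul_single, map_smul]
      exact Submodule.smul_of_tower_mem _ _ hy
    | mem y hy =>
      obtain ⟨α, rfl⟩ := hy
      rw [hb, koszulH_single b x hb]
      have h := koszulHAux_mem x s.toFinset α
      rwa [show s.toFinset.card = i from s.down.2] at h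

/-- The differential of the Koszul complex. -/
def koszulDiff (i : ℕ) : (KoszulGen.{w} n (i + 1) →₀ B) →ₗ[B] (KoszulGen.{w} n i →₀ B) :=
  koszulProj B n i ∘ₗ koszulD x c ∘ₗ koszulIncl B n (i + 1)

theorem koszulIncl_koszulDiff (i : ℕ) (p : KoszulGen.{w} n (i + 1) →₀ B) :
    koszulIncl B n i (koszulDiff x c i p) = koszulD x c (koszulIncl B n (i + 1) p) :=
  koszulIncl_koszulProj i (koszulD_incl_mem x c i p)

/-- A cycle of the Koszul complex with vanishing degree zero part is a boundary. -/
theorem exists_koszulDiff_eq (hb : ∀ α, b α = stdMonomial x α)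
    (hc : ∀ i j, x j * x i = c i j • (x i * x j)) (ε : B →ₐ[K] K) (hε : ∀ i, ε (x i) = 0)
    (i : ℕ) (z : KoszulGen.{w} n i →₀ B) (hD : koszulD x c (koszulIncl B n i z) = 0)
    (hE : koszulE ε (koszulIncl B n i z) = 0) : ∃ p, koszulDiff x c i p = z := by
  refine ⟨koszulProj B n (i + 1) (koszulH b x (koszulIncl B n i z)), koszulIncl_injective n i ?_⟩
  rw [koszulIncl_koszulDiff, koszulIncl_koszulProj _ (koszulH_incl_mem b x hb i z)]
  -- With `d z = 0` and no degree zero part, the identity reads `d (h z) = z`.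
  have h := koszul_homotopy b x c hb hc ε hε (koszulIncl B n i z)
  rwa [hD, hE, map_zero, add_zero, add_zero] at h

/-- The augmentation of the Koszul complex. -/
def koszulAug (n : ℕ) (ε : B →ₐ[K] K) : (KoszulGen.{w} n 0 →₀ B) →ₛₗ[(ε : B →+* K)] K where
  toFun p := ε (p ⟨∅, Finset.card_empty⟩)
  map_add' p q := by simp
  map_smul' r p := by simp

theorem koszulAug_eq (ε : B →ₐ[K] K) (z : KoszulGen.{w} n 0 →₀ B) :
    koszulAug n ε z = ε (koszulIncl B n 0 z ∅) :=
  congrArg ε (Finsupp.mapDomain_apply (KoszulGen.toFinset_injective n 0) z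
    ⟨∅, Finset.card_empty⟩).symm

theorem koszulD_incl_zero (z : KoszulGen.{w} n 0 →₀ B) :
    koszulD x c (koszulIncl B n 0 z) = 0 := by
  induction z using Finsupp.induction_linear with
  | zero => simp
  | add p q hp hq => rw [map_add, map_add, hp, hq, add_zero]
  | single s y =>
    rw [koszulIncl_single, koszulD_single, Finset.card_eq_zero.1 (show s.toFinset.card = 0 from
      s.down.2), Finset.sum_empty]

/-- Only stability under right multiplication by the variables is required of `𝓑`, so the lemma also
applies to families that are not gradings. -/
theorem koszulD_degree (𝓑 : ℕ → Submodule K B) (h𝓑 : ∀ k i y, y ∈ 𝓑 k → y * x i ∈ 𝓑 (k + 1))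
    (k : ℕ) (z : Finset (Fin n) →₀ B) (hz : ∀ S, z S ∈ 𝓑 k) (T : Finset (Fin n)) :
    koszulD x c z T ∈ 𝓑 (k + 1) := by
  rw [koszulD, Finsupp.linearCombination_apply, Finsupp.sum, Finsupp.finsetSum_apply]
  refine sum_mem fun S _ => ?_
  rw [Finsupp.smul_apply, Finsupp.finsetSum_apply, Finset.smul_sum]
  refine sum_mem fun s _ => ?_
  rw [Finsupp.single_apply]
  split_ifs
  · rw [smul_eq_mul, mul_smul_comm]
    exact Submodule.smul_mem _ _ (h𝓑 _ _ _ (hz S))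
  · simp

theorem koszulIncl_degree (M : Submodule K B) (i : ℕ) (p : KoszulGen.{w} n i →₀ B)
    (hp : ∀ s, p s ∈ M) (S : Finset (Fin n)) : koszulIncl B n i p S ∈ M := by
  by_cases hS : S ∈ Set.range (KoszulGen.toFinset : KoszulGen.{w} n i → Finset (Fin n))
  · obtain ⟨s, rfl⟩ := hS
    rw [koszulIncl, Finsupp.lmapDomain_apply,
      Finsupp.mapDomain_apply (KoszulGen.toFinset_injective n i)]
    exact hp s
  · rw [koszulIncl, Finsupp.lmapDomain_apply, Finsupp.mapDomain_of_notMem_range _ _ hS]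
    exact zero_mem _

/-- The Koszul resolution of an algebra in which the standard monomials in skew-commuting
variables form a basis. -/
def koszulResolution (hb : ∀ α, b α = stdMonomial x α)
    (hc : ∀ i j, x j * x i = c i j • (x i * x j)) (ε : B →ₐ[K] K) (hε : ∀ i, ε (x i) = 0)
    (𝓑 : ℕ → Submodule K B) (h𝓑 : ∀ k i y, y ∈ 𝓑 k → y * x i ∈ 𝓑 (k + 1)) :
    LinearFreeResolution 𝓑 ε where
  gen := KoszulGen.{w} n
  d := koszulDiff x c
  aug := koszulAug n ε
  d_degree i k p hp t := koszulD_degree x c 𝓑 h𝓑 k _ (koszulIncl_degree (𝓑 k) (i + 1) p hp) _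
  aug_surjective r := ⟨Finsupp.single ⟨∅, Finset.card_empty⟩ (algebraMap K B r),
    (congrArg ε Finsupp.single_eq_same).trans (ε.commutes r)⟩
  exact_zero z := by
    constructor
    · intro hz
      refine exists_koszulDiff_eq b x c hb hc ε hε 0 z (koszulD_incl_zero x c z) ?_
      rw [koszulE_apply, ← koszulAug_eq, hz, map_zero, Finsupp.single_zero]
    · rintro ⟨p, rfl⟩
      rw [koszulAug_eq, koszulIncl_koszulDiff]
      -- The family that is everything in degree zero and `ker ε` afterwards shows that the
      -- coordinates of a differential lie in `ker ε`.
      refine koszulD_degree x c (fun k => if k = 0 then ⊤ else LinearMap.ker ε.toLinearMap)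
        (fun k i y _ => ?_) 0 _ (fun S => ?_) ∅
      · simp [hε]
      · simp
  exact_succ i z := by
    constructor
    · intro hz
      have hD : koszulD x c (koszulIncl B n (i + 1) z) = 0 := by
        rw [← koszulIncl_koszulDiff, hz, map_zero]
      refine exists_koszulDiff_eq b x c hb hc ε hε (i + 1) z hD ?_
      -- `koszulE` reads only the coordinate at `∅`, which is not a set of cardinality `i + 1`.
      rw [koszulE_apply, koszulIncl, Finsupp.lmapDomain_apply, Finsupp.mapDomain_of_notMem_range,
        map_zero, map_zero, Finsupp.single_zero]
      rintro ⟨s, hs⟩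
      have := s.down.2
      rw [show s.down.1 = ∅ from hs, Finset.card_empty] at this
      exact (Nat.succ_ne_zero i) this.symm
    · rintro ⟨p, rfl⟩
      apply koszulIncl_injective n i
      rw [koszulIncl_koszulDiff, koszulIncl_koszulDiff, map_zero]
      exact LinearMap.congr_fun (koszulD_comp_self x c hc) _

end Resolution

/-! ### Quadratic algebras with skew-commuting generators -/

section QuadraticRelations

universe u v

variable {K : Type u} [Field K] {V : Type v} [AddCommGroup V] [Module K V]

theorem quadraticPart_le (P : Submodule K (TensorAlgebra K V)) :
    quadraticPart P ≤ tensorDegree K V 2 := by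
  rintro _ ⟨q, _, rfl⟩
  rw [GradedAlgebra.proj_apply]
  exact SetLike.coe_mem _

theorem ι_mem_tensorDegree (v : V) : TensorAlgebra.ι K v ∈ tensorDegree K V 1 := by
  rw [tensorDegree, pow_one]
  exact ⟨v, rfl⟩

theorem quotientDegree_mul_generator (R : Submodule K (TensorAlgebra K V)) (k : ℕ) (v : V)
    (y : TensorQuotient R) (hy : y ∈ quotientDegree R k) :
    y * generator R v ∈ quotientDegree R (k + 1) := by
  obtain ⟨t, ht, rfl⟩ := hy
  exact ⟨t * TensorAlgebra.ι K v, SetLike.mul_mem_graded ht (ι_mem_tensorDegree v),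
    map_mul (toQuotient R) _ _⟩

theorem augmentation_generator (R : Submodule K (TensorAlgebra K V))
    (hR : R ≤ tensorDegree K V 2) (v : V) : augmentation R hR (generator R v) = 0 :=
  algebraMapInv_eq_zero one_ne_zero (ι_mem_tensorDegree v)

variable {n : ℕ} (x : Module.Basis (Fin n) K V)

/-- The algebra homomorphism from `T(V)` to the trivial square zero extension of `K` by `V`,
the latter written in coordinates. -/
def tensorToTrivSqZeroExt : TensorAlgebra K V →ₐ[K] TrivSqZeroExt K (Fin n → K) :=
  TensorAlgebra.lift K (TrivSqZeroExt.inrHom K (Fin n → K) ∘ₗ x.equivFun.toLinearMap)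

theorem tensorToTrivSqZeroExt_ι (v : V) :
    tensorToTrivSqZeroExt x (TensorAlgebra.ι K v) = TrivSqZeroExt.inr (x.equivFun v) := by
  rw [tensorToTrivSqZeroExt, TensorAlgebra.lift_ι_apply]
  rfl

theorem tensorToTrivSqZeroExt_eq_zero {t : TensorAlgebra K V} (ht : t ∈ tensorDegree K V 2) :
    tensorToTrivSqZeroExt x t = 0 := by
  have h : tensorDegree K V 2 ≤ LinearMap.ker (tensorToTrivSqZeroExt x).toLinearMap := by
    rw [tensorDegree, pow_two, Submodule.mul_le]
    rintro _ ⟨v, rfl⟩ _ ⟨w, rfl⟩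
    rw [LinearMap.mem_ker, AlgHom.toLinearMap_apply, map_mul, tensorToTrivSqZeroExt_ι,
      tensorToTrivSqZeroExt_ι, TrivSqZeroExt.inr_mul_inr]
  exact h ht

/-- The homomorphism from a homogeneous quadratic algebra to the trivial square zero extension. -/
def quotientToTrivSqZeroExt (R : Submodule K (TensorAlgebra K V))
    (hR : R ≤ tensorDegree K V 2) : TensorQuotient R →ₐ[K] TrivSqZeroExt K (Fin n → K) :=
  Ideal.Quotient.liftₐ _ (tensorToTrivSqZeroExt x) (by
    intro a ha
    have h : TwoSidedIdeal.span (R : Set (TensorAlgebra K V)) ≤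
        TwoSidedIdeal.ker (tensorToTrivSqZeroExt x) :=
      TwoSidedIdeal.span_le.2 fun r hr =>
        (TwoSidedIdeal.mem_ker _).2 (tensorToTrivSqZeroExt_eq_zero x (hR hr))
    exact (TwoSidedIdeal.mem_ker _).1 (h ha))

theorem quotientToTrivSqZeroExt_generator (R : Submodule K (TensorAlgebra K V))
    (hR : R ≤ tensorDegree K V 2) (i : Fin n) :
    quotientToTrivSqZeroExt x R hR (generator R (x i)) =
      TrivSqZeroExt.inr (Pi.single i 1) := by
  refine (tensorToTrivSqZeroExt_ι x (x i)).trans (congrArg _ ?_)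
  ext j
  simp [Pi.single_apply, eq_comm]

/-- In a homogeneous quadratic algebra, the commutation relations of a skew PBW extension have no
terms of lower degree. -/
theorem exists_mul_generator_eq_smul (R : Submodule K (TensorAlgebra K V))
    (hR : R ≤ tensorDegree K V 2)
    (hB : IsSkewPBWExtension (algebraMap K (TensorQuotient R)) fun i => generator R (x i))
    (i j : Fin n) : ∃ c : K, c ≠ 0 ∧
      generator R (x j) * generator R (x i) =
        c • (generator R (x i) * generator R (x j)) := by
  obtain ⟨c, hc, r₀, r, h⟩ := hB.comm_var i j
  refine ⟨c, hc, ?_⟩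
  -- In the square zero extension the left side becomes zero, and the two components of the right
  -- side are `r₀` and `r`.
  have h' := congrArg (quotientToTrivSqZeroExt x R hR) h
  simp only [map_sub, map_mul, map_add, map_sum, quotientToTrivSqZeroExt_generator,
    TrivSqZeroExt.inr_mul_inr, mul_zero, sub_zero, AlgHom.commutes] at h'
  have h₀ : r₀ = 0 := by
    have := congrArg TrivSqZeroExt.fst h'
    simpa [TrivSqZeroExt.algebraMap_eq_inl, TrivSqZeroExt.fst_sum] using this.symm
  have h₁ : r = 0 := by
    funext k
    have := congrFun (congrArg TrivSqZeroExt.snd h') k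
    simpa [TrivSqZeroExt.algebraMap_eq_inl, TrivSqZeroExt.snd_sum, Finset.sum_apply,
      Pi.single_apply] using this.symm
  rw [h₀, h₁] at h
  rw [Algebra.smul_def]
  simpa [sub_eq_zero] using h

theorem stdMonomial_single_add_single {A : Type*} [Ring A] (y : Fin n → A) {i j : Fin n}
    (h : i ≤ j) : stdMonomial y (Pi.single i 1 + Pi.single j 1) = y i * y j := by
  rw [← stdMonomial_mul_of_forall_lt y _ j fun u hu => by simp [(h.trans_lt hu).ne']]
  have h0 := stdMonomial_mul_of_forall_lt y 0 i fun u _ => rfl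
  rw [zero_add, stdMonomial_zero, one_mul] at h0
  rw [h0]

/-- If the standard monomials form a basis of the target of `f`, then skew commutation relations
which hold in the target of `f` and of `g` imply that `g` kills the quadratic tensors killed by
`f`. -/
theorem map_eq_zero_of_skew_commuting {B C : Type*} [Ring B] [Algebra K B] [Ring C] [Algebra K C]
    (f : TensorAlgebra K V →ₐ[K] B) (g : TensorAlgebra K V →ₐ[K] C)
    (b : Module.Basis (Fin n → ℕ) K B)
    (hb : ∀ α, b α = stdMonomial (fun i => f (TensorAlgebra.ι K (x i))) α)
    (c : Fin n → Fin n → K)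
    (hf : ∀ i j, f (TensorAlgebra.ι K (x j)) * f (TensorAlgebra.ι K (x i)) =
      c i j • (f (TensorAlgebra.ι K (x i)) * f (TensorAlgebra.ι K (x j))))
    (hg : ∀ i j, g (TensorAlgebra.ι K (x j)) * g (TensorAlgebra.ι K (x i)) =
      c i j • (g (TensorAlgebra.ι K (x i)) * g (TensorAlgebra.ι K (x j))))
    {t : TensorAlgebra K V} (ht : t ∈ tensorDegree K V 2) (h0 : f t = 0) : g t = 0 := by
  -- `σ` matches standard monomials and is merely linear; it need only satisfy `σ ∘ f = g` on `V ⊗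
  -- V`.
  obtain ⟨σ, hσ⟩ : ∃ σ : B →ₗ[K] C,
      ∀ α, σ (b α) = stdMonomial (fun i => g (TensorAlgebra.ι K (x i))) α :=
    ⟨b.constr K fun α => stdMonomial (fun i => g (TensorAlgebra.ι K (x i))) α,
      fun α => b.constr_basis K _ α⟩
  have hle : ∀ i j, i ≤ j → σ (f (TensorAlgebra.ι K (x i)) * f (TensorAlgebra.ι K (x j))) =
      g (TensorAlgebra.ι K (x i)) * g (TensorAlgebra.ι K (x j)) := by
    intro i j hij
    have h := hσ (Pi.single i 1 + Pi.single j 1)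
    rwa [hb, stdMonomial_single_add_single _ hij, stdMonomial_single_add_single _ hij] at h
  have h : tensorDegree K V 2 ≤ LinearMap.eqLocus (σ ∘ₗ f.toLinearMap) g.toLinearMap := by
    rw [tensorDegree, LinearMap.range_eq_map, ← x.span_eq, Submodule.map_span, pow_two,
      Submodule.span_mul_span, Submodule.span_le]
    rintro _ ⟨_, ⟨_, ⟨i, rfl⟩, rfl⟩, _, ⟨_, ⟨j, rfl⟩, rfl⟩, rfl⟩
    simp only [SetLike.mem_coe, LinearMap.mem_eqLocus, LinearMap.comp_apply,
      AlgHom.toLinearMap_apply, map_mul]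
    rcases le_total i j with hij | hij
    · exact hle i j hij
    · rw [hf, hg, map_smul, hle j i hij]
  have h2 := h ht
  rw [LinearMap.mem_eqLocus, LinearMap.comp_apply, AlgHom.toLinearMap_apply, h0, map_zero] at h2
  exact h2.symm

/-- The basis of standard monomials of a skew PBW extension of `K`. -/
theorem exists_basis_stdMonomial {B : Type*} [Ring B] [Algebra K B] {y : Fin n → B}
    (hB : IsSkewPBWExtension (algebraMap K B) y) :
    ∃ b : Module.Basis (Fin n → ℕ) K B, ∀ α, b α = stdMonomial y α := by
  have h : Function.Bijective (Finsupp.linearCombination K (stdMonomial y)) := by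
    convert hB.basis using 1
    funext a
    simp [Finsupp.linearCombination_apply, Algebra.smul_def]
  refine ⟨.ofRepr (LinearEquiv.ofBijective _ h).symm, fun α => ?_⟩
  simp

/-- The inclusion of `R` in the skew ideal compares the two quotient maps on quadratic tensors,
using the monomial basis of `T(V) / ⟨R⟩` only. The reverse inclusion is `hc`. -/
theorem span_quadratic_eq_span_skew (R : Submodule K (TensorAlgebra K V))
    (hR : R ≤ tensorDegree K V 2)
    (hB : IsSkewPBWExtension (algebraMap K (TensorQuotient R)) fun i => generator R (x i))
    (c : Fin n → Fin n → K)
    (hc : ∀ i j, generator R (x j) * generator R (x i) =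
      c i j • (generator R (x i) * generator R (x j))) :
    TwoSidedIdeal.span (R : Set (TensorAlgebra K V)) =
      TwoSidedIdeal.span {t | ∃ i j, t =
        TensorAlgebra.ι K (x j) * TensorAlgebra.ι K (x i) -
          c i j • (TensorAlgebra.ι K (x i) * TensorAlgebra.ι K (x j))} := by
  refine le_antisymm (TwoSidedIdeal.span_le.2 fun r hr => ?_) (TwoSidedIdeal.span_le.2 ?_)
  · obtain ⟨b, hb⟩ := exists_basis_stdMonomial hB
    refine TwoSidedIdeal.mem_asIdeal.1 (Ideal.Quotient.eq_zero_iff_mem.1 ?_)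
    refine map_eq_zero_of_skew_commuting x (toQuotient R) (Ideal.Quotient.mkₐ K _) b hb c hc
      (fun i j => ?_) (hR hr) (Ideal.Quotient.eq_zero_iff_mem.2 (TwoSidedIdeal.subset_span hr))
    rw [← sub_eq_zero]
    simp only [← map_mul (Ideal.Quotient.mkₐ K _), ← map_smul (Ideal.Quotient.mkₐ K _),
      ← map_sub (Ideal.Quotient.mkₐ K _)]
    exact Ideal.Quotient.eq_zero_iff_mem.2
      (TwoSidedIdeal.mem_asIdeal.2 (TwoSidedIdeal.subset_span ⟨i, j, rfl⟩))
  · rintro _ ⟨i, j, rfl⟩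
    refine TwoSidedIdeal.mem_asIdeal.1 (Ideal.Quotient.eq_zero_iff_mem.1 ?_)
    change toQuotient R _ = 0
    rw [map_sub, map_smul, map_mul, map_mul, sub_eq_zero]
    exact hc i j

end QuadraticRelations

end PBWKoszul

end

theorem proposition4p6 {K : Type*} [Field K] {V : Type*} [AddCommGroup V] [Module K V]
    {n : ℕ} (x : Module.Basis (Fin n) K V)
    (P : Submodule K (TensorAlgebra K V)) (hA : PBWKoszul.IsPBWDeformation P)
    (hB : PBWKoszul.IsSkewPBWExtension
      (algebraMap K (PBWKoszul.TensorQuotient (PBWKoszul.quadraticPart P)))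
      (fun i => PBWKoszul.generator (PBWKoszul.quadraticPart P) (x i))) :
    PBWKoszul.IsHomogeneousKoszul (PBWKoszul.quadraticPart P) ∧
    PBWKoszul.IsSemiCommutative
      (algebraMap K (PBWKoszul.TensorQuotient (PBWKoszul.quadraticPart P)))
      (fun i => PBWKoszul.generator (PBWKoszul.quadraticPart P) (x i)) ∧
    ∃ c : Fin n → Fin n → K, (∀ i j, c i j ≠ 0) ∧
      (∀ i j, PBWKoszul.generator (PBWKoszul.quadraticPart P) (x j) *
          PBWKoszul.generator (PBWKoszul.quadraticPart P) (x i) =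
        c i j • (PBWKoszul.generator (PBWKoszul.quadraticPart P) (x i) *
          PBWKoszul.generator (PBWKoszul.quadraticPart P) (x j))) ∧
      TwoSidedIdeal.span (PBWKoszul.quadraticPart P : Set (TensorAlgebra K V)) =
        TwoSidedIdeal.span {t | ∃ i j, t =
          TensorAlgebra.ι K (x j) * TensorAlgebra.ι K (x i) -
            c i j • (TensorAlgebra.ι K (x i) * TensorAlgebra.ι K (x j))} := by
  have hR := PBWKoszul.quadraticPart_le P
  choose c hc0 hc using PBWKoszul.exists_mul_generator_eq_smul x _ hR hB
  obtain ⟨b, hb⟩ := PBWKoszul.exists_basis_stdMonomial hB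
  refine ⟨⟨Module.Finite.of_basis x, hR, ⟨PBWKoszul.koszulResolution b _ c hb hc _
      (fun i => PBWKoszul.augmentation_generator _ hR (x i)) _
      fun k i => PBWKoszul.quotientDegree_mul_generator _ k (x i)⟩⟩,
    { hB with
      -- Scalars are central, so `r` itself is the required coefficient.
      quasi_coeff := fun i r hr => ⟨r, hr, (Algebra.commutes r _).symm⟩
      quasi_var := fun i j => ⟨c i j, hc0 i j, by rw [hc i j, Algebra.smul_def]⟩
      constant := fun i r => (Algebra.commutes r _).symm },
    c, hc0, hc, PBWKoszul.span_quadratic_eq_span_skew x _ hR hB c hc⟩
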